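/- Let $R$ be a discrete valuation domain of characteristic $0$ whose maximal ideal is $pR$ for some prime number $p$, let $G$ be a finite cyclic $p$-group, and let $N$ be a (necessarily normal) subgroup of $G$. Let $M$ be an $R[G]$-lattice, i.e. a finitely generated left $R[G]$-module that is projective as an $R$-module. For a finite group $H$, an $R[H]$-module is called an $R[H]$-permutation module if it is isomorphic to $R[\Omega]$ for some finite left $H$-set $\Omega$. Suppose that (i) the restriction $\mathrm{res}^G_N(M)$ of $M$ to $N$ is an $R[N]$-permutation module, and (ii) the module $M^N$ of $N$-invariants, with its natural $G/N$-action, is an $R[G/N]$-permutation module. Then $M$ is an $R[G]$-permutation module, i.e. there exists a finite left $G$-set $\Omega$ with $M \simeq R[\Omega]$ as $R[G]$-modules. -/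

import Mathlib

namespace Representation

/-- A finitely generated left `R[G]`-module is an `R[G]`-lattice if it is projective as an
`R`-module. The left `R[G]`-module is given by a representation `ρ`. -/
structure IsLattice {R G M : Type*} [CommRing R] [Group G] [AddCommGroup M] [Module R M]
    (ρ : Representation R G M) : Prop where
  finite : Module.Finite (MonoidAlgebra R G) ρ.asModule
  projective : Module.Projective R M

/-- `ρ` is an `R[G]`-permutation module: it is isomorphic, as a representation, to `R[Ω]` for
some finite left `G`-set `Ω` (as `Ω` is finite, its universe does not matter; `Ω` may be empty). -/
def IsPermutation {R G M : Type*} [CommRing R] [Group G] [AddCommGroup M] [Module R M]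
    (ρ : Representation R G M) : Prop :=
  ∃ (Ω : Type) (_ : Finite Ω) (_ : MulAction G Ω),
    Nonempty (Representation.Equiv ρ (Representation.ofMulAction R G Ω))

end Representation

/-! Let `T` be the action of a generator of `G`, of order `p ^ n`, and let `L_k` be the kernel of `T
^ p ^ k - 1`. If `N` has index `p ^ m`, then `L_m` is the module of `N`-invariants and `L_n = M`. By
induction on `k ≥ m`, each `L_k` has a basis permuted by `T`; hypothesis (ii) is the case `k = m`.

For the step, put `S = T ^ p ^ k` and `Φ = 1 + S + ... + S ^ (p - 1)`. Hypothesis (i) enters only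
through the vanishing of `ker Φ / (S - 1) M`: if `Φ y = 0`, then `p y` lies in `(S - 1) M`, and the
coinvariants of a permutation module have no `p`-torsion
(`Module.Basis.mem_range_sub_one_of_smul_mem`). Choose elements `m_i` of `L_(k+1)` forming a basis
modulo `L_k + (T - 1) L_(k+1)`, a quotient killed by `p`. The vanishing makes the norms of the `Φ
m_i` under `1 + T + ... + T ^ (p ^ k - 1)` independent modulo `p L_k`. So the `Φ m_i` can replace
some orbits of full length `p ^ k` in the basis of `L_k` (`IsOrbitBasis.exchange`, a Steinitz
exchange). Replacing each `Φ m_i` by `m_i`, with orbit length `p ^ (k + 1)`, gives a basis of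
`L_(k+1)` (`IsOrbitBasis.lift`). Both replacements rest on Nakayama's lemma, since `T - 1` is
nilpotent modulo `p`. -/

/-! ### Orbit bases, torsion in coinvariants, and Nakayama's lemma -/

section OrbitFamilies

variable {R M : Type*} [CommRing R] [AddCommGroup M] [Module R M]

/-- The family of all translates `T ^ j (x i)` with `j < e i`. -/
def orbitFamily (T : Module.End R M) {ι : Type*} (e : ι → ℕ) (x : ι → M) :
    (Σ i, Fin (e i)) → M :=
  fun s => (T ^ (s.2 : ℕ)) (x s.1)

/-- The translates of the elements `x i`, which have period `e i` under `T`, form a basis of the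
submodule `L`. -/
structure IsOrbitBasis (T : Module.End R M) {ι : Type*} (e : ι → ℕ) (x : ι → M)
    (L : Submodule R M) : Prop where
  period : ∀ i, (T ^ e i) (x i) = x i
  linearIndependent : LinearIndependent R (orbitFamily T e x)
  span_eq : Submodule.span R (Set.range (orbitFamily T e x)) = L

theorem Module.End.pow_mul_apply_of_periodic {T : Module.End R M} {e : ℕ} {x : M}
    (h : (T ^ e) x = x) (n : ℕ) : (T ^ (e * n)) x = x := by
  induction n with
  | zero => simp
  | succ n ih => rw [Nat.mul_succ, pow_add, Module.End.mul_apply, h, ih]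

theorem Module.End.pow_apply_of_dvd {T : Module.End R M} {e n : ℕ} {x : M}
    (h : (T ^ e) x = x) (hn : e ∣ n) : (T ^ n) x = x := by
  obtain ⟨m, rfl⟩ := hn
  exact pow_mul_apply_of_periodic h m

theorem Module.End.pow_mod_apply_of_periodic {T : Module.End R M} {e : ℕ} {x : M}
    (h : (T ^ e) x = x) (n : ℕ) : (T ^ (n % e)) x = (T ^ n) x := by
  conv_rhs => rw [← Nat.mod_add_div n e, pow_add, Module.End.mul_apply,
    pow_mul_apply_of_periodic h]

theorem pow_mem_span_orbitFamily {T : Module.End R M} {ι : Type*} {e : ι → ℕ} {x : ι → M}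
    (h : ∀ i, (T ^ e i) (x i) = x i) (he : ∀ i, e i ≠ 0) (i : ι) (n : ℕ) :
    (T ^ n) (x i) ∈ Submodule.span R (Set.range (orbitFamily T e x)) := by
  refine Submodule.subset_span ⟨⟨i, n % e i, Nat.mod_lt _ (Nat.pos_of_ne_zero (he i))⟩, ?_⟩
  exact Module.End.pow_mod_apply_of_periodic (h i) n

theorem mem_span_orbitFamily {T : Module.End R M} {ι : Type*} {e : ι → ℕ} {x : ι → M}
    (h : ∀ i, (T ^ e i) (x i) = x i) (he : ∀ i, e i ≠ 0) (i : ι) :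
    x i ∈ Submodule.span R (Set.range (orbitFamily T e x)) :=
  pow_mem_span_orbitFamily h he i 0

theorem apply_mem_span_orbitFamily {T : Module.End R M} {ι : Type*} {e : ι → ℕ} {x : ι → M}
    (h : ∀ i, (T ^ e i) (x i) = x i) (he : ∀ i, e i ≠ 0) {v : M}
    (hv : v ∈ Submodule.span R (Set.range (orbitFamily T e x))) :
    T v ∈ Submodule.span R (Set.range (orbitFamily T e x)) := by
  refine Submodule.span_induction (p := fun v _ => T v ∈ _) ?_ (by simp) ?_ ?_ hv
  · rintro _ ⟨⟨i, j⟩, rfl⟩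
    have := pow_mem_span_orbitFamily h he i (j + 1)
    rwa [pow_succ', Module.End.mul_apply] at this
  · intro a b _ _ ha hb; rw [map_add]; exact add_mem ha hb
  · intro r a _ ha; rw [map_smul]; exact Submodule.smul_mem _ r ha

theorem pow_apply_mem_of_apply_mem {T : Module.End R M} {L : Submodule R M}
    (hT : ∀ v ∈ L, T v ∈ L) (n : ℕ) {v : M} (hv : v ∈ L) : (T ^ n) v ∈ L := by
  induction n with
  | zero => exact hv
  | succ n ih => rw [pow_succ', Module.End.mul_apply]; exact hT _ ih

theorem span_orbitFamily_le {T : Module.End R M} {ι : Type*} {e : ι → ℕ} {x : ι → M}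
    {L : Submodule R M} (hT : ∀ v ∈ L, T v ∈ L) (hx : ∀ i, x i ∈ L) :
    Submodule.span R (Set.range (orbitFamily T e x)) ≤ L := by
  rw [Submodule.span_le]
  rintro _ ⟨⟨i, j⟩, rfl⟩
  exact pow_apply_mem_of_apply_mem hT _ (hx i)

/-- If `T` permutes a basis and `p` is a nonzero prime element, then the coinvariants of `T` have
no `p`-torsion. -/
theorem Module.Basis.mem_range_sub_one_of_smul_mem {Ω : Type*} [IsDomain R]
    (b : Module.Basis Ω R M) [Finite Ω] (π : Equiv.Perm Ω) {T : Module.End R M}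
    (hT : ∀ ω, T (b ω) = b (π ω)) {ϖ : R} (hϖ : ϖ ≠ 0) {w z : M} (h : ϖ • w = T z - z) :
    ∃ y, w = T y - y := by
  classical
  cases nonempty_fintype Ω
  have coord : ∀ v ω, b.repr (T v) (π ω) = b.repr v ω := by
    intro v ω
    have : (b.coord (π ω)).comp T = b.coord ω := by
      refine b.ext fun ω' => ?_
      simp [hT, Finsupp.single_apply]
    simpa using LinearMap.congr_fun this v
  let s : Setoid Ω := Equiv.Perm.SameCycle.setoid π
  let rep : Ω → Ω := fun ω => (Quotient.mk s ω).out
  have hrep : ∀ ω, π.SameCycle (rep ω) ω := fun ω =>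
    Quotient.exact (Quotient.out_eq (Quotient.mk s ω))
  have hrepπ : ∀ ω, rep (π ω) = rep ω := by
    intro ω
    have : Quotient.mk s (π ω) = Quotient.mk s ω :=
      Quotient.sound (show π.SameCycle (π ω) ω from Equiv.Perm.sameCycle_apply_left.2 (Equiv.Perm.SameCycle.refl _ _))
    simp only [rep, this]
  -- In coordinates, `ϖ • w = T z - z` says that the coordinates of `z` are constant modulo `ϖ`
  -- along each cycle. Hence `z` is a `T`-invariant vector plus `ϖ • y`, and `ϖ` cancels.
  have hdiv : ∀ ω ω', π.SameCycle ω ω' → ϖ ∣ b.repr z ω' - b.repr z ω := by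
    intro ω ω' hs
    obtain ⟨n, rfl⟩ := hs.exists_nat_pow_eq
    induction n with
    | zero => simp
    | succ n ih =>
      have h1 := congrArg (fun v => b.repr v (π ((π ^ n) ω))) h
      simp only [map_smul, map_sub, Finsupp.smul_apply, Finsupp.sub_apply, coord,
        smul_eq_mul] at h1
      rw [pow_succ', Equiv.Perm.mul_apply]
      obtain ⟨c, hc⟩ := ih ⟨n, by simp⟩
      exact ⟨c - b.repr w (π ((π ^ n) ω)), by rw [mul_sub, h1, ← hc]; ring⟩
  choose c hc using fun ω => hdiv (rep ω) ω (hrep ω)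
  have hz : z = ∑ ω, b.repr z (rep ω) • b ω + ϖ • ∑ ω, c ω • b ω := by
    conv_lhs => rw [← b.sum_repr z]
    rw [Finset.smul_sum, ← Finset.sum_add_distrib]
    refine Finset.sum_congr rfl fun ω _ => ?_
    rw [smul_smul, ← hc, ← add_smul]; congr 1; ring
  have hinv : T (∑ ω, b.repr z (rep ω) • b ω) = ∑ ω, b.repr z (rep ω) • b ω := by
    rw [map_sum, ← Equiv.sum_comp π (fun ω => b.repr z (rep ω) • b ω)]
    simp [hT, hrepπ]
  refine ⟨∑ ω, c ω • b ω, ?_⟩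
  have := Module.Free.of_basis b
  refine smul_right_injective M hϖ ?_
  simp only
  rw [h, hz, map_add, hinv, map_smul, smul_sub]
  abel

/-- The polynomial `1 + X + ... + X ^ (p - 1) - p` vanishes at `1`. Thus `p` is the norm up to a
multiple of `T - 1`. -/
theorem exists_geomSum_eq {A : Type*} [Ring A] (T : A) (p : ℕ) : ∃ Ψ : A,
    ∑ j ∈ Finset.range p, T ^ j = p + (T - 1) * Ψ := by
  have : (Polynomial.X - Polynomial.C 1 : Polynomial ℤ) ∣
      ∑ j ∈ Finset.range p, (Polynomial.X : Polynomial ℤ) ^ j - (p : Polynomial ℤ) := by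
    rw [Polynomial.dvd_iff_isRoot]
    simp [Polynomial.eval_finsetSum]
  obtain ⟨Ψ, h⟩ := this
  refine ⟨Polynomial.aeval T Ψ, ?_⟩
  have := congrArg (Polynomial.aeval T) h
  simp only [map_sub, map_sum, map_pow, Polynomial.aeval_X, map_natCast, map_mul, map_one] at this
  rw [← this]; abel

/-- Binomial expansion of `T = (T - 1) + 1`. The error term is a polynomial in `T`, so it preserves
every `T`-stable submodule. -/
theorem exists_sub_one_pow_prime_pow_eq {A : Type*} [Ring A] (T : A) {p : ℕ} (hp : p.Prime)
    (k : ℕ) : ∃ r : Polynomial ℤ,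
      (T - 1) ^ p ^ k = T ^ p ^ k - 1 - p * Polynomial.aeval T r := by
  obtain ⟨r, h⟩ := exists_add_pow_prime_pow_eq hp (Polynomial.X - 1 : Polynomial ℤ) 1 k
  refine ⟨(Polynomial.X - 1) * r, ?_⟩
  have := congrArg (Polynomial.aeval T) h
  simp only [sub_add_cancel, map_add, map_mul, map_sub, map_pow, Polynomial.aeval_X, map_one,
    map_natCast, one_pow, mul_one] at this ⊢
  rw [this]; simp only [mul_assoc]; abel

theorem aeval_int_apply_mem {T : Module.End R M} {L : Submodule R M}
    (hT : ∀ v ∈ L, T v ∈ L) (r : Polynomial ℤ) {v : M} (hv : v ∈ L) :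
    Polynomial.aeval T r v ∈ L := by
  rw [Polynomial.aeval_eq_sum_range, LinearMap.sum_apply]
  refine sum_mem fun j _ => ?_
  rw [LinearMap.smul_apply]
  exact zsmul_mem (pow_apply_mem_of_apply_mem hT j hv) _

/-- In a module over a ring with `p` in its Jacobson radical, an automorphism of `p`-power order
acts unipotently modulo `p`, which gives the following form of Nakayama's lemma. -/
theorem Submodule.le_of_forall_exists_add_sub_add_smul {T : Module.End R M} {p : ℕ}
    (hp : p.Prime) (hpR : (p : R) ∈ Ideal.jacobson (⊥ : Ideal R)) (k : ℕ)
    {L N : Submodule R M} (hL : L.FG) (hTL : ∀ x ∈ L, (T ^ p ^ k) x = x)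
    (hTL' : ∀ x ∈ L, T x ∈ L) (hTN : ∀ x ∈ N, T x ∈ N)
    (h : ∀ x ∈ L, ∃ n ∈ N, ∃ y ∈ L, ∃ z ∈ L, x = n + (T y - y) + (p : R) • z) : L ≤ N := by
  -- Substituting the hypothesis into itself gives `L ⊆ N + (T - 1) ^ j L + p L`. For `j = p ^ k`
  -- the middle term lies in `p L`, and the usual Nakayama lemma applies.
  have key : ∀ j : ℕ, ∀ x ∈ L, ∃ n ∈ N, ∃ y ∈ L, ∃ z ∈ L,
      x = n + ((T - 1) ^ j) y + (p : R) • z := by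
    intro j
    induction j with
    | zero => intro x hx; exact ⟨0, zero_mem _, x, hx, 0, zero_mem _, by simp⟩
    | succ j ih =>
      intro x hx
      obtain ⟨n, hn, y, hy, z, hz, rfl⟩ := h x hx
      obtain ⟨n', hn', y', hy', z', hz', rfl⟩ := ih y hy
      refine ⟨n + (T n' - n'), add_mem hn (sub_mem (hTN _ hn') hn'), y', hy',
        T z' - z' + z, add_mem (sub_mem (hTL' _ hz') hz') hz, ?_⟩
      rw [pow_succ', Module.End.mul_apply]
      simp only [map_add, map_smul, LinearMap.sub_apply, Module.End.one_apply, smul_add, smul_sub]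
      abel
  obtain ⟨r, hr⟩ := exists_sub_one_pow_prime_pow_eq T hp k
  refine Submodule.le_of_le_smul_of_le_jacobson_bot (I := Ideal.span {(p : R)}) hL ?_ ?_
  · rwa [Ideal.span_singleton_le_iff_mem]
  · intro x hx
    obtain ⟨n, hn, y, hy, z, hz, rfl⟩ := key (p ^ k) x hx
    rw [add_assoc]
    refine Submodule.add_mem_sup hn ?_
    have : ((T - 1) ^ p ^ k) y = - ((p : R) • Polynomial.aeval T r y) := by
      rw [hr, LinearMap.sub_apply, LinearMap.sub_apply, hTL y hy, Module.End.one_apply, sub_self,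
        zero_sub, Module.End.mul_apply, Nat.cast_smul_eq_nsmul, Module.End.natCast_apply]
    rw [this, neg_add_eq_sub, ← smul_sub]
    exact Submodule.smul_mem_smul (Ideal.mem_span_singleton_self _)
      (sub_mem hz (aeval_int_apply_mem hTL' r hy))

/-- The augmentation map of a submodule with an orbit basis. -/
theorem IsOrbitBasis.exists_augmentation {T : Module.End R M} {ι : Type*} [Fintype ι]
    [DecidableEq ι] {e : ι → ℕ}
    {x : ι → M} {L : Submodule R M} (hb : IsOrbitBasis T e x L) (he : ∀ i, e i ≠ 0) :
    ∃ η : L →ₗ[R] (ι → R), (∀ i, ∀ u : L, (u : M) = x i → η u = Pi.single i 1) ∧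
      ∀ u : L, ∃ y ∈ L, (u : M) = ∑ i, η u i • x i + (T y - y) := by
  obtain ⟨hper, hli, rfl⟩ := hb
  let b := Module.Basis.span hli
  have hb : ∀ s, (b s : M) = orbitFamily T e x s := fun s =>
    congrArg Subtype.val (Module.Basis.span_apply hli s)
  -- All translates of `x i` have the same image, so `η` computes coinvariants.
  let η := b.constr R (fun s => (Pi.single s.1 1 : ι → R))
  have hη : ∀ s, η (b s) = Pi.single s.1 1 := fun s => b.constr_basis R _ s
  refine ⟨η, fun i u hu => ?_, fun u => ?_⟩
  · have : u = b ⟨i, 0, Nat.pos_of_ne_zero (he i)⟩ := by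
      apply Subtype.ext; rw [hb, hu]; rfl
    rw [this, hη]
  · let L := Submodule.span R (Set.range (orbitFamily T e x))
    let D : L →ₗ[R] M := L.subtype - (Fintype.linearCombination R x).comp η
    have hD : ⊤ ≤ (L.map (T - 1)).comap D := by
      rw [← b.span_eq, Submodule.span_le]
      rintro _ ⟨⟨i, j⟩, rfl⟩
      refine ⟨∑ l ∈ Finset.range j, (T ^ l) (x i), sum_mem fun l _ =>
        pow_mem_span_orbitFamily hper he i l, ?_⟩
      have h1 := LinearMap.congr_fun (mul_geom_sum T j) (x i)
      rw [Module.End.mul_apply, LinearMap.sum_apply] at h1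
      rw [h1]
      simp [D, L, hη, hb, orbitFamily, Fintype.linearCombination_apply, Pi.single_apply]
    obtain ⟨y, hy, h⟩ := hD (Submodule.mem_top (x := u))
    refine ⟨y, hy, ?_⟩
    simp only [D, LinearMap.sub_apply, Module.End.one_apply, Submodule.subtype_apply,
      LinearMap.comp_apply, Fintype.linearCombination_apply] at h
    rw [h]; abel

end OrbitFamilies

/-! ### Exchange of orbits over a local ring -/

theorem exists_linearIndependent_sum_single {k I : Type*} [Field k] [Finite I] [DecidableEq I]
    {r : ℕ} {v : Fin r → I → k} (hv : LinearIndependent k v) :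
    ∃ J : Set I,
      LinearIndependent k (Sum.elim v (fun j : J => (Pi.single (j : I) 1 : I → k))) ∧
      ⊤ ≤ Submodule.span k
        (Set.range (Sum.elim v (fun j : J => (Pi.single (j : I) 1 : I → k)))) := by
  let E : I → I → k := fun i => Pi.single i 1
  have hE : Function.Injective E := fun i j h => by
    by_contra hij
    have := congrFun h i
    simp [E, hij] at this
  obtain ⟨b, hbt, hsb, hspan, hli⟩ := exists_linearIndepOn_id_extension
    (s := Set.range v) (t := Set.range v ∪ Set.range E) hv.linearIndepOn_id
    Set.subset_union_left
  have hEspan : ⊤ ≤ Submodule.span k (Set.range E) := by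
    have := (Pi.basisFun k I).span_eq
    rw [← this]
    refine Submodule.span_mono ?_
    rintro _ ⟨i, rfl⟩
    exact ⟨i, by simp [E]⟩
  -- Standard vectors already among the `v` are left out, so that the joint family is injective.
  let J : Set I := {i | E i ∈ b ∧ E i ∉ Set.range v}
  have hrange : Set.range (Sum.elim v (fun j : J => E j)) = b := by
    ext w
    rw [Set.Sum.elim_range]
    constructor
    · rintro (h | ⟨j, rfl⟩)
      · exact hsb h
      · exact j.2.1
    · intro hw
      by_cases h : w ∈ Set.range v
      · exact Or.inl h
      · rcases hbt hw with h' | ⟨i, rfl⟩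
        · exact Or.inl h'
        · exact Or.inr ⟨⟨i, hw, h⟩, rfl⟩
  refine ⟨J, ?_, ?_⟩
  · have hinj : Function.Injective (Sum.elim v (fun j : J => E j)) := by
      refine hv.injective.sumElim (fun i j h => Subtype.ext (hE h)) ?_
      intro a j h
      exact j.2.2 ⟨a, h⟩
    rw [← hrange] at hli
    exact (linearIndepOn_id_range_iff hinj).1 hli
  · change ⊤ ≤ Submodule.span k (Set.range (Sum.elim v (fun j : J => E j)))
    rw [hrange]
    refine hEspan.trans (Submodule.span_le.2 ?_)
    exact Set.subset_union_right.trans hspan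

section LocalRing

variable {R M : Type*} [CommRing R] [IsLocalRing R] [AddCommGroup M] [Module R M]

/-- Elements of a finite module over a local ring which form a basis of its quotient by a submodule
containing `𝔪 M`. -/
theorem exists_basis_modulo [Module.Finite R M] (W : Submodule R M)
    (hW : ∀ r ∈ IsLocalRing.maximalIdeal R, ∀ x : M, r • x ∈ W) :
    ∃ (r : ℕ) (v : Fin r → M), (∀ x, ∃ c : Fin r → R, x - ∑ i, c i • v i ∈ W) ∧
      ∀ c : Fin r → R, ∑ i, c i • v i ∈ W → ∀ i, c i ∈ IsLocalRing.maximalIdeal R := by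
  have htors : Module.IsTorsionBySet R (M ⧸ W) (IsLocalRing.maximalIdeal R : Set R) := by
    rintro x ⟨a, ha⟩
    obtain ⟨x, rfl⟩ := W.mkQ_surjective x
    change a • W.mkQ x = 0
    rw [← map_smul]
    exact (Submodule.Quotient.mk_eq_zero W).2 (hW a ha x)
  let _ : Module (IsLocalRing.ResidueField R) (M ⧸ W) := htors.module
  have : IsScalarTower R (IsLocalRing.ResidueField R) (M ⧸ W) := htors.isScalarTower
  have : Module.Finite (IsLocalRing.ResidueField R) (M ⧸ W) :=
    Module.Finite.of_restrictScalars_finite R _ _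
  let b := Module.finBasis (IsLocalRing.ResidueField R) (M ⧸ W)
  choose v hv using fun i => W.mkQ_surjective (b i)
  have hsmul : ∀ (a : R) (x : M ⧸ W), IsLocalRing.residue R a • x = a • x := fun a x => by
    rw [← IsLocalRing.ResidueField.algebraMap_eq, algebraMap_smul]
  refine ⟨_, v, fun x => ?_, fun c hc i => ?_⟩
  · choose c hc using fun i => IsLocalRing.residue_surjective (b.repr (W.mkQ x) i)
    refine ⟨c, (Submodule.Quotient.mk_eq_zero W).1 ?_⟩
    change W.mkQ _ = 0
    rw [map_sub, map_sum]
    simp only [map_smul, hv, ← hsmul, hc, b.sum_repr, sub_self]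
  · have h : W.mkQ (∑ i, c i • v i) = 0 := (Submodule.Quotient.mk_eq_zero W).2 hc
    rw [map_sum] at h
    simp only [map_smul, hv, ← hsmul] at h
    rw [← IsLocalRing.residue_eq_zero_iff]
    exact Fintype.linearIndependent_iff.1 b.linearIndependent _ h i

end LocalRing

theorem IsOrbitBasis.apply_mem {R M : Type*} [CommRing R] [AddCommGroup M] [Module R M]
    {T : Module.End R M} {ι : Type*} {e : ι → ℕ} {x : ι → M} {L : Submodule R M}
    (hb : IsOrbitBasis T e x L) (he : ∀ i, e i ≠ 0) {v : M} (hv : v ∈ L) : T v ∈ L := by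
  rw [← hb.span_eq] at hv ⊢
  exact apply_mem_span_orbitFamily hb.period he hv

theorem IsOrbitBasis.mem {R M : Type*} [CommRing R] [AddCommGroup M] [Module R M]
    {T : Module.End R M} {ι : Type*} {e : ι → ℕ} {x : ι → M} {L : Submodule R M}
    (hb : IsOrbitBasis T e x L) (he : ∀ i, e i ≠ 0) (i : ι) : x i ∈ L := by
  rw [← hb.span_eq]
  exact mem_span_orbitFamily hb.period he i

theorem sum_range_mul_pow_apply {R M : Type*} [CommRing R] [AddCommGroup M] [Module R M]
    {T : Module.End R M} {e : ℕ} {x : M} (h : (T ^ e) x = x) (n : ℕ) :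
    ∑ j ∈ Finset.range (e * n), (T ^ j) x = n • ∑ j ∈ Finset.range e, (T ^ j) x := by
  induction n with
  | zero => simp
  | succ n ih =>
    rw [Nat.mul_succ, Finset.sum_range_add, ih, succ_nsmul]
    congr 1
    refine Finset.sum_congr rfl fun j _ => ?_
    rw [add_comm, pow_add, Module.End.mul_apply, Module.End.pow_mul_apply_of_periodic h]

/-- Elements of `L` whose norms are independent modulo `p L` can be completed to an orbit basis
of `L`. -/
theorem IsOrbitBasis.exchange {R M : Type*} [CommRing R] [IsLocalRing R] [AddCommGroup M]
    [Module R M] {p : ℕ} (hp : p.Prime)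
    (hR : IsLocalRing.maximalIdeal R = Ideal.span {(p : R)})
    {T : Module.End R M} {k : ℕ} {ι : Type} [Fintype ι] {e : ι → ℕ} {x : ι → M}
    {L : Submodule R M} (hb : IsOrbitBasis T e x L) (he : ∀ i, e i ∣ p ^ k)
    {r : ℕ} {l : Fin r → M} (hl : ∀ i, l i ∈ L)
    (hind : ∀ c : Fin r → R, (∃ w ∈ L, ∑ j ∈ Finset.range (p ^ k), (T ^ j) (∑ i, c i • l i) =
      (p : R) • w) → ∀ i, c i ∈ IsLocalRing.maximalIdeal R) :
    ∃ (ι' : Type) (_ : Fintype ι') (e' : ι' → ℕ) (x' : ι' → M), (∀ i, e' i ∣ p ^ k) ∧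
      IsOrbitBasis T (Sum.elim (fun _ : Fin r => p ^ k) e') (Sum.elim l x') L := by
  classical
  have hq0 : p ^ k ≠ 0 := pow_ne_zero _ hp.ne_zero
  have he0 : ∀ i, e i ≠ 0 := fun i h => hq0 (Nat.eq_zero_of_zero_dvd (h ▸ he i))
  have hTL : ∀ v ∈ L, T v ∈ L := fun v hv => hb.apply_mem he0 hv
  have hxL := hb.mem he0
  have hper : ∀ v ∈ L, (T ^ p ^ k) v = v := by
    have : L ≤ LinearMap.eqLocus (T ^ p ^ k) LinearMap.id := by
      rw [← hb.span_eq, Submodule.span_le]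
      rintro _ ⟨⟨i, j⟩, rfl⟩
      change (T ^ p ^ k) ((T ^ (j : ℕ)) (x i)) = (T ^ (j : ℕ)) (x i)
      rw [← Module.End.mul_apply, ← pow_add, add_comm, pow_add, Module.End.mul_apply,
        Module.End.pow_apply_of_dvd (hb.period i) (he i)]
    exact this
  have hpm : (p : R) ∈ IsLocalRing.maximalIdeal R := by
    rw [hR]; exact Ideal.mem_span_singleton_self _
  obtain ⟨η, hηx, hη⟩ := hb.exists_augmentation he0
  -- Only full orbits matter modulo `p`: on an orbit of length `e i < p ^ k` the norm is `p ^ k / e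
  -- i` times the orbit sum, hence divisible by `p`. So `ε u = 0` forces the norm of `u` into `p L`.
  let I := {i // e i = p ^ k}
  let ε : L →ₗ[R] (I → IsLocalRing.ResidueField R) :=
    LinearMap.pi fun i => (Algebra.linearMap R (IsLocalRing.ResidueField R)).comp
      ((LinearMap.proj i.1).comp η)
  have hε : ∀ u i, ε u i = IsLocalRing.residue R (η u i.1) := fun u i => rfl
  -- the kernel of `ε`
  have hker : ∀ u : L, ε u = 0 → ∀ i : I, ∃ d : R, η u i.1 = p * d := by
    intro u hu i
    have : IsLocalRing.residue R (η u i.1) = 0 := by rw [← hε, hu]; rfl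
    rw [IsLocalRing.residue_eq_zero_iff, hR, Ideal.mem_span_singleton] at this
    exact this
  have hnorm : ∀ u : L, ε u = 0 → ∃ w ∈ L,
      ∑ j ∈ Finset.range (p ^ k), (T ^ j) (u : M) = (p : R) • w := by
    intro u hu
    obtain ⟨y, hy, h⟩ := hη u
    let ν : Module.End R M := ∑ j ∈ Finset.range (p ^ k), T ^ j
    have hν : ∀ v, ν v = ∑ j ∈ Finset.range (p ^ k), (T ^ j) v := fun v =>
      LinearMap.sum_apply _ _ _
    have hν0 : ν (T y - y) = 0 := by
      have := LinearMap.congr_fun (geom_sum_mul T (p ^ k)) y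
      rw [Module.End.mul_apply] at this
      simpa [ν, hper y hy] using this
    have hνL : ∀ v ∈ L, ν v ∈ L := fun v hv => by
      rw [hν]; exact sum_mem fun j _ => pow_apply_mem_of_apply_mem hTL j hv
    have hterm : ∀ i, ∃ w ∈ L, η u i • ν (x i) = (p : R) • w := by
      intro i
      by_cases hi : e i = p ^ k
      · obtain ⟨d, hd⟩ := hker u hu ⟨i, hi⟩
        exact ⟨d • ν (x i), L.smul_mem _ (hνL _ (hxL i)), by rw [hd, smul_smul]⟩
      · obtain ⟨a, ha⟩ := he i
        have hpa : p ∣ a := by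
          obtain ⟨b, -, hb⟩ := (Nat.dvd_prime_pow hp).1 (Dvd.intro_left _ ha.symm)
          cases b with
          | zero => rw [hb, pow_zero, mul_one] at ha; exact absurd ha.symm hi
          | succ b => rw [hb, pow_succ]; exact dvd_mul_left _ _
        obtain ⟨d, rfl⟩ := hpa
        refine ⟨η u i • (d : R) • ∑ j ∈ Finset.range (e i), (T ^ j) (x i),
          L.smul_mem _ (L.smul_mem _ (sum_mem fun j _ =>
            pow_apply_mem_of_apply_mem hTL j (hxL i))), ?_⟩
        rw [hν, ha, sum_range_mul_pow_apply (hb.period i), ← Nat.cast_smul_eq_nsmul R]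
        simp only [smul_smul]
        congr 1; push_cast; ring
    choose w hw hw' using hterm
    refine ⟨∑ i, w i, sum_mem fun i _ => hw i, ?_⟩
    rw [← hν, h, map_add, hν0, add_zero, map_sum, Finset.smul_sum]
    exact Finset.sum_congr rfl fun i _ => by rw [map_smul, hw']
  let l' : Fin r → L := fun i => ⟨l i, hl i⟩
  have hv : LinearIndependent (IsLocalRing.ResidueField R) (fun i => ε (l' i)) := by
    rw [Fintype.linearIndependent_iff]
    intro c' hc i
    choose c hcc using fun i => IsLocalRing.residue_surjective (c' i)
    have h1 : ε (∑ i, c i • l' i) = 0 := by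
      rw [← hc, map_sum]
      refine Finset.sum_congr rfl fun i _ => ?_
      rw [map_smul, ← hcc, ← IsLocalRing.ResidueField.algebraMap_eq, algebraMap_smul]
    have h2 := hnorm _ h1
    have h3 : ((∑ i, c i • l' i : L) : M) = ∑ i, c i • l i := by simp [l']
    rw [h3] at h2
    rw [← hcc, IsLocalRing.residue_eq_zero_iff]
    exact hind c h2 i
  obtain ⟨J, hJli, hJspan⟩ := exists_linearIndependent_sum_single hv
  -- The short orbits are all kept; among the full ones only those indexed by `J` survive, the
  -- others giving way to the `l i`.
  let ι' := J ⊕ {i // e i ≠ p ^ k}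
  let old : ι' → ι := Sum.elim (fun j => j.1.1) (fun i => i.1)
  have hold : ∀ i, e (old i) ∣ p ^ k := fun i => he _
  let e₁ : Fin r ⊕ ι' → ℕ := Sum.elim (fun _ => p ^ k) (e ∘ old)
  let x₁ : Fin r ⊕ ι' → M := Sum.elim l (x ∘ old)
  have he₁ : ∀ i, e₁ i ≠ 0 := by
    rintro (i | i)
    · exact hq0
    · exact he0 _
  have hper₁ : ∀ i, (T ^ e₁ i) (x₁ i) = x₁ i := by
    rintro (i | i)
    · exact hper _ (hl i)
    · exact hb.period _
  have hx₁ : ∀ i, x₁ i ∈ L := by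
    rintro (i | i)
    · exact hl i
    · exact hxL _
  let N := Submodule.span R (Set.range (orbitFamily T e₁ x₁))
  have hNL : N ≤ L := span_orbitFamily_le hTL hx₁
  have hTN : ∀ v ∈ N, T v ∈ N := fun v hv => apply_mem_span_orbitFamily hper₁ he₁ hv
  have hx₁N : ∀ i, x₁ i ∈ N := fun i => mem_span_orbitFamily hper₁ he₁ i
  -- `L = N + (T - 1) L + p L`
  let D : Submodule R M := N ⊔ (L.map (T - 1) ⊔ L.map (LinearMap.lsmul R M (p : R)))
  have hDmem : ∀ u : L, ε u = 0 → (u : M) ∈ D := by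
    intro u hu
    obtain ⟨y, hy, h⟩ := hη u
    rw [h]
    refine add_mem (sum_mem fun i _ => ?_)
      (Submodule.mem_sup_right (Submodule.mem_sup_left ⟨y, hy, by simp⟩))
    by_cases hi : e i = p ^ k
    · obtain ⟨d, hd⟩ := hker u hu ⟨i, hi⟩
      refine Submodule.mem_sup_right (Submodule.mem_sup_right
        ⟨d • x i, L.smul_mem _ (hxL i), ?_⟩)
      simp [hd, smul_smul, mul_comm]
    · exact Submodule.mem_sup_left (N.smul_mem _ (hx₁N (Sum.inr (Sum.inr ⟨i, hi⟩))))
  have hx' : ∀ i, x i ∈ D := by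
    intro i
    by_cases hi : e i = p ^ k
    · let u : L := ⟨x i, hxL i⟩
      obtain ⟨c', hc'⟩ := (Submodule.mem_span_range_iff_exists_fun _).1
        (hJspan (Submodule.mem_top (x := ε u)))
      choose c hcc using fun i => IsLocalRing.residue_surjective (c' i)
      let x₂ : Fin r ⊕ J → L := Sum.elim l' (fun j => ⟨x j.1.1, hxL _⟩)
      have hε₂ : ∀ s, ε (x₂ s) = Sum.elim (fun i => ε (l' i))
          (fun j : J => (Pi.single (j : I) 1 : I → IsLocalRing.ResidueField R)) s := by
        rintro (i | j)
        · rfl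
        · ext i'
          simp only [x₂, Sum.elim_inr, hε]
          rw [hηx j.1.1 _ rfl]
          by_cases h : i' = j.1
          · subst h; simp
          · have h' : i'.1 ≠ j.1.1 := fun h' => h (Subtype.ext h')
            simp [h, h']
      have h1 : ε (u - ∑ s, c s • x₂ s) = 0 := by
        rw [map_sub, ← hc', map_sum, sub_eq_zero]
        refine Finset.sum_congr rfl fun s _ => ?_
        rw [map_smul, hε₂, ← hcc, ← IsLocalRing.ResidueField.algebraMap_eq, algebraMap_smul]
      have h2 : (x i : M) = ((u - ∑ s, c s • x₂ s : L) : M) + ∑ s, c s • (x₂ s : M) := by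
        simp [u]
      rw [h2]
      refine add_mem (hDmem _ h1) (Submodule.mem_sup_left (sum_mem fun s _ => N.smul_mem _ ?_))
      rcases s with s | s
      · exact hx₁N (Sum.inl s)
      · exact hx₁N (Sum.inr (Sum.inl s))
    · exact Submodule.mem_sup_left (hx₁N (Sum.inr (Sum.inr ⟨i, hi⟩)))
  have hLN : L ≤ N := by
    refine Submodule.le_of_forall_exists_add_sub_add_smul hp ?_ k
      ⟨(Set.finite_range (orbitFamily T e x)).toFinset, by
        rw [Set.Finite.coe_toFinset, hb.span_eq]⟩ hper hTL hTN ?_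
    · rwa [IsLocalRing.jacobson_eq_maximalIdeal _ bot_ne_top]
    · intro u hu
      have : u ∈ D := by
        obtain ⟨y, hy, h⟩ := hη ⟨u, hu⟩
        change u = _ at h
        rw [h]
        exact add_mem (sum_mem fun i _ => D.smul_mem _ (hx' i))
          (Submodule.mem_sup_right (Submodule.mem_sup_left ⟨y, hy, by simp⟩))
      obtain ⟨n, hn, _, h, rfl⟩ := Submodule.mem_sup.1 this
      obtain ⟨_, ⟨y, hy, rfl⟩, _, ⟨z, hz, rfl⟩, rfl⟩ := Submodule.mem_sup.1 h
      exact ⟨n, hn, y, hy, z, hz, by simp [add_assoc]⟩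
  have hspan : N = L := le_antisymm hNL hLN
  refine ⟨ι', inferInstance, e ∘ old, x ∘ old, hold, hper₁, ?_, hspan⟩
  -- The vectors `ε (l' i)` and the standard vectors in `J` form a basis of the residue space on
  -- `I`. Hence old and new families have equal size, and a spanning family of that size is
  -- independent.
  have hrJ : r + Fintype.card J = Fintype.card I := by
    have := Module.finrank_eq_card_basis (Module.Basis.mk hJli hJspan)
    simpa using this.symm
  have hcard : Fintype.card (Σ i, Fin (e₁ i)) = Fintype.card (Σ i, Fin (e i)) := by
    have h1 : ∑ i, e i = ∑ i : I, e i.1 + ∑ i : {i // e i ≠ p ^ k}, e i.1 :=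
      (Fintype.sum_subtype_add_sum_subtype (fun i => e i = p ^ k) e).symm
    have h2 : ∑ i : I, e i.1 = Fintype.card I * p ^ k := by
      rw [Finset.sum_congr rfl fun i _ => i.2]; simp
    have h3 : ∑ j : J, e j.1.1 = Fintype.card J * p ^ k := by
      rw [Finset.sum_congr rfl fun j _ => j.1.2]; simp
    simp only [Fintype.card_sigma, Fintype.card_fin, Fintype.sum_sum_type, e₁, ι', old,
      Sum.elim_inl, Sum.elim_inr, Function.comp_apply, Finset.sum_const, Finset.card_univ,
      smul_eq_mul]
    rw [h1, h2, h3, ← hrJ]; ring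
  refine linearIndependent_iff_card_eq_finrank_span.2 ?_
  have h1 := linearIndependent_iff_card_eq_finrank_span.1 hb.linearIndependent
  rw [Set.finrank, hb.span_eq] at h1
  change _ = Module.finrank R N
  rw [hspan, ← h1]
  exact hcard

/-! ### Lifting an orbit basis of the invariants -/

theorem finRotate_mod {a : ℕ} (ha : 0 < a) (n : ℕ) :
    finRotate a ⟨n % a, Nat.mod_lt _ ha⟩ = ⟨(n + 1) % a, Nat.mod_lt _ ha⟩ := by
  cases a with
  | zero => exact absurd ha (lt_irrefl _)
  | succ a =>
    rw [finRotate_apply, Fin.ext_iff, Fin.val_add]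
    simp [Nat.add_mod]

/-- The permutation of a disjoint union of cycles which rotates each cycle. -/
theorem exists_perm_sigma_fin {ι : Type*} (e : ι → ℕ) (he : ∀ i, 0 < e i) :
    ∃ π : Equiv.Perm (Σ i, Fin (e i)), ∀ i (n : ℕ),
      (π ^ n) ⟨i, 0, he i⟩ = ⟨i, n % e i, Nat.mod_lt _ (he i)⟩ := by
  refine ⟨Equiv.sigmaCongrRight fun i => finRotate (e i), fun i n => ?_⟩
  induction n with
  | zero => simp
  | succ n ih =>
    rw [pow_succ', Equiv.Perm.mul_apply, ih, ← finRotate_mod (he i)]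
    rfl

theorem Module.End.mem_ker_pow_sub_one {R M : Type*} [CommRing R] [AddCommGroup M] [Module R M]
    (T : Module.End R M) (n : ℕ) (v : M) : v ∈ LinearMap.ker (T ^ n - 1) ↔ (T ^ n) v = v := by
  rw [LinearMap.mem_ker, LinearMap.sub_apply, Module.End.one_apply, sub_eq_zero]

section Lift

variable {R M : Type*} [CommRing R] [AddCommGroup M] [Module R M]

variable (R M) in
/-- The free module on cycles of lengths `e i`. -/
theorem exists_free_orbitBasis {ι : Type*} (e : ι → ℕ) (he : ∀ i, e i ≠ 0) :
    ∃ (π : Equiv.Perm (Σ i, Fin (e i))) (S : Module.End R ((Σ i, Fin (e i)) →₀ R))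
      (ε : ι → ((Σ i, Fin (e i)) →₀ R)),
      (∀ s n, (S ^ n) (Finsupp.single s 1) = Finsupp.single ((π ^ n) s) 1) ∧
      (∀ i, (S ^ e i) (ε i) = ε i) ∧
      (∀ s, orbitFamily S e ε s = Finsupp.single s 1) ∧
      ∀ (T : Module.End R M) (x : ι → M), (∀ i, (T ^ e i) (x i) = x i) → ∀ v,
        Finsupp.linearCombination R (orbitFamily T e x) (S v) =
          T (Finsupp.linearCombination R (orbitFamily T e x) v) := by
  obtain ⟨π, hπ⟩ := exists_perm_sigma_fin e fun i => Nat.pos_of_ne_zero (he i)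
  have hS : ∀ s n, ((Finsupp.lmapDomain R R π : Module.End R _) ^ n) (Finsupp.single s 1) =
      Finsupp.single ((π ^ n) s) 1 := by
    intro s n
    induction n with
    | zero => simp
    | succ n ih => rw [pow_succ', Module.End.mul_apply, ih]; simp [pow_succ']
  refine ⟨π, Finsupp.lmapDomain R R π,
    fun i => Finsupp.single ⟨i, 0, Nat.pos_of_ne_zero (he i)⟩ 1, hS, fun i => ?_, ?_, ?_⟩
  · rw [hS, hπ]; simp
  · rintro ⟨i, j⟩
    rw [orbitFamily, hS, hπ]
    simp [Nat.mod_eq_of_lt j.2]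
  · intro T x hx v
    refine LinearMap.congr_fun (f := (Finsupp.linearCombination R (orbitFamily T e x)).comp
      (Finsupp.lmapDomain R R π)) (g := T.comp (Finsupp.linearCombination R (orbitFamily T e x)))
      (Finsupp.lhom_ext' fun ⟨i, j⟩ => LinearMap.ext_ring ?_) v
    have h : π ⟨i, j⟩ = ⟨i, (j + 1) % e i, Nat.mod_lt _ (Nat.pos_of_ne_zero (he i))⟩ := by
      rw [← hπ, pow_succ', Equiv.Perm.mul_apply, hπ]
      simp [Nat.mod_eq_of_lt j.2]
    simp only [LinearMap.comp_apply, Finsupp.lsingle_apply, Finsupp.lmapDomain_apply,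
      Finsupp.mapDomain_single, Finsupp.linearCombination_single, one_smul, h, orbitFamily]
    rw [Module.End.pow_mod_apply_of_periodic (hx i), pow_succ', Module.End.mul_apply]

theorem Module.End.geomSum_pow_apply_of_periodic {T : Module.End R M} {q : ℕ} {x : M}
    (h : (T ^ q) x = x) (p : ℕ) :
    (∑ j ∈ Finset.range p, (T ^ q) ^ j) x = (p : R) • x := by
  rw [LinearMap.sum_apply, Finset.sum_congr rfl fun j _ => by
    rw [← pow_mul, pow_mul_apply_of_periodic h]]
  simp [Nat.cast_smul_eq_nsmul]

theorem Module.End.pow_apply_geomSum {T : Module.End R M} {q p : ℕ} {x : M}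
    (h : (T ^ (q * p)) x = x) :
    (T ^ q) ((∑ j ∈ Finset.range p, (T ^ q) ^ j) x) = (∑ j ∈ Finset.range p, (T ^ q) ^ j) x := by
  have := LinearMap.congr_fun (mul_geom_sum (T ^ q) p) x
  rw [Module.End.mul_apply] at this
  simpa [← pow_mul, h, sub_eq_zero] using this

theorem map_pow_apply_of_comp {P : Type*} [AddCommGroup P] [Module R P] {F : P →ₗ[R] M}
    {S : Module.End R P} {T : Module.End R M} (h : ∀ v, F (S v) = T (F v)) (n : ℕ) (v : P) :
    F ((S ^ n) v) = (T ^ n) (F v) := by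
  induction n with
  | zero => rfl
  | succ n ih => rw [pow_succ', Module.End.mul_apply, h, ih, pow_succ', Module.End.mul_apply]

/-- Elements whose norms form part of an orbit basis of the invariants of `T ^ p ^ k`, and which
generate modulo these invariants, form part of an orbit basis of the whole module. -/
theorem IsOrbitBasis.lift [IsDomain R] [IsNoetherianRing R] [Module.Finite R M]
    [Module.IsTorsionFree R M] {p : ℕ} (hp : p.Prime) (hp0 : (p : R) ≠ 0)
    (hpR : (p : R) ∈ Ideal.jacobson (⊥ : Ideal R)) {T : Module.End R M} {k : ℕ}
    (hT : ∀ v, (T ^ p ^ (k + 1)) v = v)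
    {r : ℕ} {m : Fin r → M} {ι' : Type} [Fintype ι'] {e' : ι' → ℕ} {x' : ι' → M}
    (he' : ∀ i, e' i ∣ p ^ k)
    (hb : IsOrbitBasis T (Sum.elim (fun _ : Fin r => p ^ k) e')
      (Sum.elim (fun i => (∑ j ∈ Finset.range p, (T ^ p ^ k) ^ j) (m i)) x')
      (LinearMap.ker (T ^ p ^ k - 1)))
    (hgen : ∀ x, ∃ c : Fin r → R, ∃ l ∈ LinearMap.ker (T ^ p ^ k - 1), ∃ y z,
      x = ∑ i, c i • m i + l + (T y - y) + (p : R) • z) :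
    IsOrbitBasis T (Sum.elim (fun _ : Fin r => p ^ (k + 1)) e') (Sum.elim m x') ⊤ := by
  classical
  have hq0 : p ^ k ≠ 0 := pow_ne_zero _ hp.ne_zero
  have he'0 : ∀ i, e' i ≠ 0 := fun i h => hq0 (Nat.eq_zero_of_zero_dvd (h ▸ he' i))
  set e₀ : Fin r ⊕ ι' → ℕ := Sum.elim (fun _ => p ^ k) e' with he₀
  set x₀ : Fin r ⊕ ι' → M :=
    Sum.elim (fun i => (∑ j ∈ Finset.range p, (T ^ p ^ k) ^ j) (m i)) x' with hx₀
  set e₁ : Fin r ⊕ ι' → ℕ := Sum.elim (fun _ => p ^ (k + 1)) e' with he₁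
  set x₁ : Fin r ⊕ ι' → M := Sum.elim m x' with hx₁
  have he₀0 : ∀ i, e₀ i ≠ 0 := by
    rintro (i | i)
    exacts [hq0, he'0 i]
  have he₁0 : ∀ i, e₁ i ≠ 0 := by
    rintro (i | i)
    exacts [pow_ne_zero _ hp.ne_zero, he'0 i]
  have he₁dvd : ∀ i, e₁ i ∣ p ^ (k + 1) := by
    rintro (i | i)
    exacts [dvd_rfl, (he' i).trans (pow_dvd_pow _ k.le_succ)]
  have hper₁ : ∀ i, (T ^ e₁ i) (x₁ i) = x₁ i := by
    rintro (i | i)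
    exacts [hT _, hb.period (Sum.inr i)]
  -- generation
  have hspan : Submodule.span R (Set.range (orbitFamily T e₁ x₁)) = ⊤ := by
    set N := Submodule.span R (Set.range (orbitFamily T e₁ x₁)) with hN
    have hTN : ∀ v ∈ N, T v ∈ N := fun v hv => apply_mem_span_orbitFamily hper₁ he₁0 hv
    have hxN : ∀ i, x₁ i ∈ N := fun i => mem_span_orbitFamily hper₁ he₁0 i
    have hLN : LinearMap.ker (T ^ p ^ k - 1) ≤ N := by
      rw [← hb.span_eq]
      refine span_orbitFamily_le hTN ?_
      rintro (i | i)
      · rw [hx₀, Sum.elim_inl, LinearMap.sum_apply]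
        refine sum_mem fun j _ => ?_
        rw [← pow_mul]
        exact pow_apply_mem_of_apply_mem hTN _ (hxN (Sum.inl i))
      · exact hxN (Sum.inr i)
    refine top_le_iff.1 (Submodule.le_of_forall_exists_add_sub_add_smul hp hpR (k + 1)
      Module.Finite.fg_top (fun x _ => hT x) (fun _ _ => Submodule.mem_top) hTN ?_)
    intro x _
    obtain ⟨c, l, hl, y, z, h⟩ := hgen x
    exact ⟨_, add_mem (sum_mem fun i _ => N.smul_mem (c i) (hxN (Sum.inl i))) (hLN hl), y,
      Submodule.mem_top, z, Submodule.mem_top, h⟩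
  refine ⟨hper₁, ?_, hspan⟩
  -- independence
  obtain ⟨π, S, ε, hSπ, hSε, hSfam, hSF⟩ := exists_free_orbitBasis R M e₁ he₁0
  let P := (Σ i, Fin (e₁ i)) →₀ R
  let F : P →ₗ[R] M := Finsupp.linearCombination R (orbitFamily T e₁ x₁)
  have hεspan : Submodule.span R (Set.range (orbitFamily S e₁ ε)) = ⊤ := by
    rw [← (Finsupp.basisSingleOne (R := R)).span_eq]
    congr 2
    ext s : 1
    rw [hSfam, Finsupp.coe_basisSingleOne]
  have hFε : ∀ i, F (ε i) = x₁ i := by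
    intro i
    have := hSfam ⟨i, 0, Nat.pos_of_ne_zero (he₁0 i)⟩
    simp only [orbitFamily, pow_zero, Module.End.one_apply] at this
    rw [this, Finsupp.linearCombination_single, one_smul]
    rfl
  have hFS : ∀ v, F (S v) = T (F v) := hSF T x₁ hper₁
  have hFSn : ∀ n v, F ((S ^ n) v) = (T ^ n) (F v) := map_pow_apply_of_comp hFS
  have hS1 : ∀ v, (S ^ p ^ (k + 1)) v = v := by
    have : (⊤ : Submodule R P) ≤ LinearMap.eqLocus (S ^ p ^ (k + 1)) LinearMap.id := by
      rw [← hεspan]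
      refine span_orbitFamily_le (fun v hv => ?_) fun i =>
        Module.End.pow_apply_of_dvd (hSε i) (he₁dvd i)
      change (S ^ p ^ (k + 1)) v = v at hv
      change (S ^ p ^ (k + 1)) (S v) = S v
      rw [← Module.End.mul_apply, ← pow_succ, pow_succ', Module.End.mul_apply, hv]
    exact fun v => this Submodule.mem_top
  have hS1' : ∀ v, (S ^ (p ^ k * p)) v = v := by simpa only [pow_succ] using hS1
  set Φ : Module.End R P := ∑ j ∈ Finset.range p, (S ^ p ^ k) ^ j with hΦ
  have hFΦ : ∀ v, F (Φ v) = (∑ j ∈ Finset.range p, (T ^ p ^ k) ^ j) (F v) := by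
    intro v
    simp only [hΦ, LinearMap.sum_apply, map_sum, ← pow_mul, hFSn]
  have hΦS : ∀ v, Φ (S v) = S (Φ v) := by
    intro v
    have : Commute Φ S := by
      refine Commute.sum_left _ _ _ fun j _ => ?_
      rw [← pow_mul]
      exact (Commute.refl S).pow_left _
    exact LinearMap.congr_fun this v
  -- These lift the given orbit basis of `ker (T ^ p ^ k - 1)` to `P`, so `F` maps their span `Q`
  -- isomorphically onto that kernel.
  let z : Fin r ⊕ ι' → P := Sum.elim (fun i => Φ (ε (Sum.inl i))) (fun i => ε (Sum.inr i))
  have hzq : ∀ i, (S ^ p ^ k) (z i) = z i := by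
    rintro (i | i)
    · exact Module.End.pow_apply_geomSum (hS1' _)
    · exact Module.End.pow_apply_of_dvd (hSε (Sum.inr i)) (he' i)
  have hz : ∀ i, (S ^ e₀ i) (z i) = z i := by
    rintro (i | i)
    · exact hzq (Sum.inl i)
    · exact hSε (Sum.inr i)
  have hFz : ∀ i, F (z i) = x₀ i := by
    rintro (i | i)
    · exact (hFΦ _).trans (congrArg _ (hFε (Sum.inl i)))
    · exact hFε (Sum.inr i)
  have hFfam : ∀ s, F (orbitFamily S e₀ z s) = orbitFamily T e₀ x₀ s := by
    rintro ⟨i, j⟩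
    rw [orbitFamily, hFSn, hFz]; rfl
  set Q := Submodule.span R (Set.range (orbitFamily S e₀ z)) with hQ
  have hSQ : ∀ v ∈ Q, S v ∈ Q := fun v hv => apply_mem_span_orbitFamily hz he₀0 hv
  have hQinv : Q ≤ LinearMap.ker (S ^ p ^ k - 1) := by
    refine span_orbitFamily_le (fun v hv => ?_) fun i => (Module.End.mem_ker_pow_sub_one _ _ _).2 (hzq i)
    rw [Module.End.mem_ker_pow_sub_one] at hv ⊢
    rw [← Module.End.mul_apply, ← pow_succ, pow_succ', Module.End.mul_apply, hv]
  have hΦQ : ∀ v, Φ v ∈ Q := by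
    have : (⊤ : Submodule R P) ≤ Q.comap Φ := by
      rw [← hεspan]
      refine span_orbitFamily_le (fun v hv => ?_) ?_
      · rw [Submodule.mem_comap] at hv ⊢
        rw [hΦS]; exact hSQ _ hv
      · rintro (i | i)
        · exact mem_span_orbitFamily hz he₀0 (Sum.inl i)
        · have := Module.End.geomSum_pow_apply_of_periodic (hzq (Sum.inr i)) p
          rw [Submodule.mem_comap]
          change Φ (z (Sum.inr i)) ∈ Q
          rw [this]
          exact Q.smul_mem _ (mem_span_orbitFamily hz he₀0 (Sum.inr i))
    exact fun v => this Submodule.mem_top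
  have hQinj : ∀ v ∈ Q, F v = 0 → v = 0 := by
    intro v hv hv0
    obtain ⟨g, rfl⟩ := (Finsupp.mem_span_range_iff_exists_finsupp).1 hv
    have : Finsupp.linearCombination R (orbitFamily T e₀ x₀) g = 0 := by
      rw [← hv0, Finsupp.linearCombination_apply, Finsupp.sum, Finsupp.sum, map_sum]
      exact Finset.sum_congr rfl fun s _ => by rw [map_smul, hFfam]
    rw [linearIndependent_iff.1 hb.linearIndependent g this]
    simp
  have hQsurj : ∀ l ∈ LinearMap.ker (T ^ p ^ k - 1), ∃ v ∈ Q, F v = l := by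
    have : LinearMap.ker (T ^ p ^ k - 1) ≤ Q.map F := by
      rw [← hb.span_eq, Submodule.span_le]
      rintro _ ⟨s, rfl⟩
      exact ⟨_, Submodule.subset_span ⟨s, rfl⟩, hFfam s⟩
    exact fun l hl => this hl
  -- This is `ker F = (S ^ p ^ k - 1) (ker F)`. As `Φ f` lies in `Q`, it vanishes, so `f = (S ^ p ^
  -- k - 1) h`. Then `F h` is invariant, and subtracting its preimage in `Q` moves `h` into `ker F`.
  have hstep : ∀ f, F f = 0 → ∃ h, F h = 0 ∧ f = (S ^ p ^ k - 1) h := by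
    intro f hf
    have h1 : Φ f = 0 := hQinj _ (hΦQ f) (by rw [hFΦ, hf, map_zero])
    obtain ⟨Ψ, hΨ⟩ := exists_geomSum_eq (S ^ p ^ k) p
    have h2 : (p : R) • f = (S ^ p ^ k) (- Ψ f) - (- Ψ f) := by
      have := LinearMap.congr_fun hΨ f
      rw [← hΦ, h1, LinearMap.add_apply, Module.End.mul_apply, Module.End.natCast_apply,
        ← Nat.cast_smul_eq_nsmul R, LinearMap.sub_apply, Module.End.one_apply] at this
      rw [eq_neg_of_add_eq_zero_left this.symm, map_neg]; abel
    obtain ⟨h, hh⟩ := (Finsupp.basisSingleOne (R := R)).mem_range_sub_one_of_smul_mem (π ^ p ^ k)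
      (T := S ^ p ^ k) (fun s => by simpa using hSπ s (p ^ k)) hp0 h2
    obtain ⟨h₀, hh₀, hFh₀⟩ := hQsurj (F h) (by
      rw [Module.End.mem_ker_pow_sub_one, ← hFSn, ← sub_eq_zero, ← map_sub, ← hh, hf])
    refine ⟨h - h₀, by rw [map_sub, hFh₀, sub_self], ?_⟩
    have := (Module.End.mem_ker_pow_sub_one _ _ _).1 (hQinv hh₀)
    rw [map_sub, LinearMap.sub_apply, LinearMap.sub_apply, Module.End.one_apply,
      Module.End.one_apply, this, sub_self, sub_zero, hh]
  have hiter : ∀ n f, F f = 0 → ∃ h, F h = 0 ∧ f = ((S ^ p ^ k - 1 : Module.End R _) ^ n) h := by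
    intro n
    induction n with
    | zero => exact fun f hf => ⟨f, hf, rfl⟩
    | succ n ih =>
      intro f hf
      obtain ⟨g, hg, rfl⟩ := hstep f hf
      obtain ⟨h, hh, rfl⟩ := ih g hg
      exact ⟨h, hh, by rw [pow_succ', Module.End.mul_apply]⟩
  -- The `p`-th power of `S ^ p ^ k - 1` is divisible by `p`, because `(S ^ p ^ k) ^ p = 1`. As `M`
  -- is torsion-free, the quotient by `p` stays in `ker F`, so `ker F = p (ker F)`.
  have hK : LinearMap.ker F = ⊥ := by
    refine Submodule.eq_bot_of_le_smul_of_le_jacobson_bot (Ideal.span {(p : R)}) _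
      (IsNoetherian.noetherian _) ?_ ((Ideal.span_singleton_le_iff_mem _).2 hpR)
    intro f hf
    obtain ⟨h, hh, rfl⟩ := hiter (p ^ 1) f hf
    obtain ⟨s, hs⟩ := exists_sub_one_pow_prime_pow_eq (S ^ p ^ k) hp 1
    have h1 : ((S ^ p ^ k - 1 : Module.End R _) ^ p ^ 1) h =
        (p : R) • (- Polynomial.aeval (S ^ p ^ k) s h) := by
      rw [hs, LinearMap.sub_apply, LinearMap.sub_apply, Module.End.one_apply, ← pow_mul, pow_one,
        hS1', sub_self, zero_sub, Module.End.mul_apply, smul_neg, Nat.cast_smul_eq_nsmul,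
        Module.End.natCast_apply]
    rw [h1] at hf ⊢
    refine Submodule.smul_mem_smul (Ideal.mem_span_singleton_self _) ?_
    rw [LinearMap.mem_ker, map_smul] at hf
    exact (smul_eq_zero.1 hf).resolve_left hp0
  exact LinearMap.ker_eq_bot.1 hK

end Lift

/-! ### The induction step -/

section Step

variable {R M : Type*} [CommRing R] [AddCommGroup M] [Module R M]

/-- `L` has a basis permuted by `T` whose orbits have lengths dividing `n`. -/
def HasOrbitBasis (T : Module.End R M) (n : ℕ) (L : Submodule R M) : Prop :=
  ∃ (ι : Type) (_ : Fintype ι) (e : ι → ℕ) (x : ι → M), (∀ i, e i ∣ n) ∧ IsOrbitBasis T e x L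

theorem HasOrbitBasis.top_of_ker [IsDomain R] [IsLocalRing R] [IsNoetherianRing R]
    [Module.Finite R M] [Module.IsTorsionFree R M] {p : ℕ} (hp : p.Prime) (hp0 : (p : R) ≠ 0)
    (hR : IsLocalRing.maximalIdeal R = Ideal.span {(p : R)}) {T : Module.End R M} {k : ℕ}
    (hT : ∀ v, (T ^ p ^ (k + 1)) v = v)
    (hb : HasOrbitBasis T (p ^ k) (LinearMap.ker (T ^ p ^ k - 1)))
    (H : ∀ y, (∑ j ∈ Finset.range p, (T ^ p ^ k) ^ j) y = 0 → ∃ z, y = (T ^ p ^ k) z - z) :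
    HasOrbitBasis T (p ^ (k + 1)) ⊤ := by
  obtain ⟨ι, _, e, x, he, hb⟩ := hb
  set L := LinearMap.ker (T ^ p ^ k - 1) with hL
  have hLmem : ∀ v, v ∈ L ↔ (T ^ p ^ k) v = v := Module.End.mem_ker_pow_sub_one T (p ^ k)
  have hpm : (p : R) ∈ IsLocalRing.maximalIdeal R := by
    rw [hR]; exact Ideal.mem_span_singleton_self _
  have hT' : ∀ v, (T ^ (p ^ k * p)) v = v := by simpa only [pow_succ] using hT
  have hTL : ∀ v ∈ L, T v ∈ L := by
    intro v hv
    rw [hLmem] at hv ⊢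
    rw [← Module.End.mul_apply, ← pow_succ, pow_succ', Module.End.mul_apply, hv]
  set Φ : Module.End R M := ∑ j ∈ Finset.range p, (T ^ p ^ k) ^ j with hΦ
  set ν : Module.End R M := ∑ j ∈ Finset.range (p ^ k), T ^ j with hν
  have hΦL : ∀ v, Φ v ∈ L := fun v => (hLmem _).2 (Module.End.pow_apply_geomSum (hT' v))
  have hΦp : ∀ v ∈ L, Φ v = (p : R) • v := fun v hv =>
    Module.End.geomSum_pow_apply_of_periodic ((hLmem v).1 hv) p
  have hνsub : ∀ v, ν (T v - v) = (T ^ p ^ k) v - v := fun v =>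
    LinearMap.congr_fun (geom_sum_mul T (p ^ k)) v
  have hsubν : ∀ v, T (ν v) - ν v = (T ^ p ^ k) v - v := fun v =>
    LinearMap.congr_fun (mul_geom_sum T (p ^ k)) v
  have hΦν : ∀ v, Φ (ν v) = ν (Φ v) := by
    have : Commute Φ ν := Commute.sum_left _ _ _ fun i _ => Commute.sum_right _ _ _ fun j _ => by
      rw [← pow_mul]
      exact (Commute.refl T).pow_pow _ _
    exact fun v => LinearMap.congr_fun this v
  -- On `L` the operator `Φ` is multiplication by `p`, while it kills the image of `T ^ p ^ k - 1`.
  have hinj : ∀ v, (T ^ p ^ k) v - v ∈ L → v ∈ L := by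
    intro v hv
    have h1 : Φ ((T ^ p ^ k) v - v) = 0 := by
      have := LinearMap.congr_fun (geom_sum_mul (T ^ p ^ k) p) v
      rw [Module.End.mul_apply, ← hΦ] at this
      simpa [← pow_mul, hT'] using this
    rw [hΦp _ hv] at h1
    exact (hLmem v).2 (sub_eq_zero.1 ((smul_eq_zero.1 h1).resolve_left hp0))
  -- The quotient is killed by `p`: one has `p = Φ - (T ^ p ^ k - 1) Ψ` and `T ^ p ^ k - 1 = (T - 1)
  -- ν`.
  obtain ⟨r, m, hgen, hind⟩ := exists_basis_modulo (L ⊔ LinearMap.range (T - 1)) (by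
    intro a ha v
    rw [hR, Ideal.mem_span_singleton] at ha
    obtain ⟨b, rfl⟩ := ha
    obtain ⟨Ψ, hΨ⟩ := exists_geomSum_eq (T ^ p ^ k) p
    have h1 := LinearMap.congr_fun hΨ (b • v)
    rw [← hΦ, LinearMap.add_apply, Module.End.natCast_apply, ← Nat.cast_smul_eq_nsmul R,
      smul_smul] at h1
    rw [eq_sub_of_add_eq h1.symm]
    refine sub_mem (Submodule.mem_sup_left (hΦL _)) (Submodule.mem_sup_right ⟨ν (Ψ (b • v)), hsubν _⟩))
  obtain ⟨ι', hι', e', x', he', hb'⟩ := hb.exchange hp hR he (l := fun i => Φ (m i))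
    (fun i => hΦL _) (by
      rintro c ⟨w, hw, h⟩
      refine hind c ?_
      set μ := ∑ i, c i • m i with hμ
      have h1 : ν (Φ μ) = (p : R) • w := by
        rw [← h, hν, LinearMap.sum_apply, hμ, map_sum]
        simp only [map_smul]
      -- By `H`, `ν μ - w = (T ^ p ^ k - 1) z = ν (T z - z)`. So `ν` maps `μ - (T z - z)` to `w`,
      -- and applying `T - 1` shows through `hinj` that this element lies in `L`.
      have h2 : Φ (ν μ - w) = 0 := by rw [map_sub, hΦν, h1, hΦp w hw, sub_self]
      obtain ⟨z, hz⟩ := H _ h2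
      have h3 : ν (μ - (T z - z)) = w := by rw [map_sub, hνsub, ← hz]; abel
      have h4 : μ - (T z - z) ∈ L := by
        apply hinj
        rw [← hsubν, h3]
        exact sub_mem (hTL _ hw) hw
      have h5 : μ = (μ - (T z - z)) + (T - 1) z := by simp
      rw [h5]
      exact Submodule.add_mem_sup h4 ⟨z, rfl⟩)
  refine ⟨_, inferInstance, _, _, ?_, IsOrbitBasis.lift hp hp0 ?_ hT he' hb' ?_⟩
  · rintro (i | i)
    exacts [dvd_rfl, (he' i).trans (pow_dvd_pow _ k.le_succ)]
  · rwa [IsLocalRing.jacobson_eq_maximalIdeal _ bot_ne_top]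
  · intro v
    obtain ⟨c, hc⟩ := hgen v
    obtain ⟨l, hl, _, ⟨y, rfl⟩, h⟩ := Submodule.mem_sup.1 hc
    refine ⟨c, l, hl, y, 0, ?_⟩
    rw [smul_zero, add_zero, add_assoc, add_comm, ← sub_eq_iff_eq_add, ← h]
    simp

/-- Allows `HasOrbitBasis.top_of_ker` to be applied with `ker (T ^ p ^ (k + 1) - 1)` as the ambient
module. -/
theorem isOrbitBasis_map_subtype_iff {T : Module.End R M} {L : Submodule R M}
    (hT : ∀ v ∈ L, T v ∈ L) {ι : Type*} {e : ι → ℕ} {x : ι → L} {L' : Submodule R L} :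
    IsOrbitBasis T e (fun i => (x i : M)) (L'.map L.subtype) ↔
      IsOrbitBasis (T.restrict hT) e x L' := by
  have hpow : ∀ n (v : L), (((T.restrict hT) ^ n) v : M) = (T ^ n) v :=
    map_pow_apply_of_comp (F := L.subtype) (fun _ => rfl)
  have hfam : orbitFamily T e (fun i => (x i : M)) =
      L.subtype ∘ orbitFamily (T.restrict hT) e x := by
    ext s
    exact (hpow _ _).symm
  have hli := L.subtype.linearIndependent_iff (v := orbitFamily (T.restrict hT) e x)
    (LinearMap.ker_eq_bot.2 L.injective_subtype)
  have hspan : Submodule.span R (Set.range (orbitFamily T e (fun i => (x i : M)))) =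
      (Submodule.span R (Set.range (orbitFamily (T.restrict hT) e x))).map L.subtype := by
    rw [hfam, Set.range_comp, Submodule.map_span]
  constructor
  · rintro ⟨h1, h2, h3⟩
    refine ⟨fun i => Subtype.ext ((hpow _ _).trans (h1 i)), hli.1 (hfam ▸ h2), ?_⟩
    exact Submodule.map_injective_of_injective L.injective_subtype (hspan ▸ h3)
  · rintro ⟨h1, h2, h3⟩
    exact ⟨fun i => (hpow _ _).symm.trans (congrArg _ (h1 i)), hfam ▸ hli.2 h2, by rw [hspan, h3]⟩

/-- Induction step: an orbit basis of the invariants of `T ^ p ^ k` gives one for the invariants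
of `T ^ p ^ (k + 1)`, provided that a cohomology group of the quotient vanishes. -/
theorem HasOrbitBasis.succ [IsDomain R] [IsLocalRing R] [IsNoetherianRing R]
    [Module.Finite R M] [Module.IsTorsionFree R M] {p : ℕ} (hp : p.Prime) (hp0 : (p : R) ≠ 0)
    (hR : IsLocalRing.maximalIdeal R = Ideal.span {(p : R)}) {T : Module.End R M} {k : ℕ}
    (hb : HasOrbitBasis T (p ^ k) (LinearMap.ker (T ^ p ^ k - 1)))
    (H : ∀ y, (∑ j ∈ Finset.range p, (T ^ p ^ k) ^ j) y = 0 → ∃ z, y = (T ^ p ^ k) z - z) :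
    HasOrbitBasis T (p ^ (k + 1)) (LinearMap.ker (T ^ p ^ (k + 1) - 1)) := by
  set L := LinearMap.ker (T ^ p ^ (k + 1) - 1) with hL
  have hLmem : ∀ v, v ∈ L ↔ (T ^ p ^ (k + 1)) v = v :=
    Module.End.mem_ker_pow_sub_one T (p ^ (k + 1))
  have hT : ∀ v ∈ L, T v ∈ L := by
    intro v hv
    rw [hLmem] at hv ⊢
    rw [← Module.End.mul_apply, ← pow_succ, pow_succ', Module.End.mul_apply, hv]
  have hpow : ∀ n (v : L), (((T.restrict hT) ^ n) v : M) = (T ^ n) v :=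
    map_pow_apply_of_comp (F := L.subtype) (fun _ => rfl)
  have hker : (LinearMap.ker ((T.restrict hT) ^ p ^ k - 1)).map L.subtype =
      LinearMap.ker (T ^ p ^ k - 1) := by
    ext v
    rw [Module.End.mem_ker_pow_sub_one]
    constructor
    · rintro ⟨w, hw, rfl⟩
      rw [SetLike.mem_coe, Module.End.mem_ker_pow_sub_one] at hw
      exact (hpow _ _).symm.trans (congrArg _ hw)
    · intro hv
      have hvL : v ∈ L := (hLmem v).2
        (Module.End.pow_apply_of_dvd hv (pow_dvd_pow _ k.le_succ))
      refine ⟨⟨v, hvL⟩, ?_, rfl⟩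
      rw [SetLike.mem_coe, Module.End.mem_ker_pow_sub_one]
      exact Subtype.ext ((hpow _ _).trans hv)
  obtain ⟨ι, _, e, x, he, hb⟩ := hb
  have he0 : ∀ i, e i ≠ 0 := fun i h =>
    pow_ne_zero k hp.ne_zero (Nat.eq_zero_of_zero_dvd (h ▸ he i))
  have hxL : ∀ i, x i ∈ L := by
    intro i
    have := hb.mem he0 i
    rw [← hker] at this
    obtain ⟨w, -, hw⟩ := this
    rw [← hw]; exact w.2
  rw [← hker] at hb
  have hb' := (isOrbitBasis_map_subtype_iff hT (x := fun i => (⟨x i, hxL i⟩ : L))).1 hb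
  have := HasOrbitBasis.top_of_ker hp hp0 hR (T := T.restrict hT) (k := k)
    (fun v => Subtype.ext ((hpow _ _).trans ((hLmem v).1 v.2))) ⟨ι, ‹_›, e, _, he, hb'⟩ (by
      intro y hy
      have hy' : (∑ j ∈ Finset.range p, (T ^ p ^ k) ^ j) (y : M) = 0 := by
        rw [LinearMap.sum_apply] at hy ⊢
        have := congrArg Subtype.val hy
        simpa [← pow_mul, hpow] using this
      obtain ⟨z, hz⟩ := H y hy'
      -- The vanishing `H` concerns all of `M`, but its witness is automatically in `L`: `(T ^ p ^
      -- (k + 1) - 1) z` is the norm of `y`, which is zero.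
      have hzL : z ∈ L := by
        have h1 := LinearMap.congr_fun (geom_sum_mul (T ^ p ^ k) p) z
        rw [Module.End.mul_apply, LinearMap.sub_apply, Module.End.one_apply, ← hz, hy',
          ← pow_mul, ← pow_succ] at h1
        exact (hLmem z).2 (sub_eq_zero.1 (by simpa using h1.symm))
      refine ⟨⟨z, hzL⟩, Subtype.ext ?_⟩
      rw [Submodule.coe_sub, hpow]
      exact hz)
  obtain ⟨ι', hι', e', x', he', h⟩ := this
  refine ⟨ι', hι', e', fun i => x' i, he', ?_⟩
  have h2 := (isOrbitBasis_map_subtype_iff hT).2 h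
  rwa [Submodule.map_subtype_top] at h2

end Step

/-! ### Permutation representations and orbit bases -/

theorem exists_orbit_decomposition {Ω : Type} [Finite Ω] (π : Equiv.Perm Ω) {n : ℕ}
    (hπ : π ^ n = 1) :
    ∃ (ι : Type) (_ : Fintype ι) (e : ι → ℕ) (a : ι → Ω), (∀ i, e i ∣ n) ∧
      (∀ i, (π ^ e i) (a i) = a i) ∧
      Function.Bijective fun s : Σ i, Fin (e i) => (π ^ (s.2 : ℕ)) (a s.1) := by
  classical
  let s : Setoid Ω := Equiv.Perm.SameCycle.setoid π
  let a : Quotient s → Ω := Quotient.out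
  have ha : ∀ ω, π.SameCycle (a (Quotient.mk s ω)) ω := fun ω =>
    Quotient.exact (Quotient.out_eq (Quotient.mk s ω))
  have hper : ∀ i, (π ^ Function.minimalPeriod π (a i)) (a i) = a i := by
    intro i
    rw [← Equiv.Perm.iterate_eq_pow]
    exact Function.iterate_minimalPeriod
  have hmod : ∀ i (m : ℕ), (π ^ (m % Function.minimalPeriod π (a i))) (a i) = (π ^ m) (a i) := by
    intro i m
    rw [← Equiv.Perm.iterate_eq_pow, ← Equiv.Perm.iterate_eq_pow]
    exact Function.iterate_mod_minimalPeriod_eq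
  have hpos : ∀ i, 0 < Function.minimalPeriod π (a i) := fun i =>
    Function.minimalPeriod_pos_of_mem_periodicPts
      (Function.Injective.mem_periodicPts π.injective (a i))
  refine ⟨Quotient s, Fintype.ofFinite _, fun i => Function.minimalPeriod π (a i), a,
    fun i => Function.IsPeriodicPt.minimalPeriod_dvd ?_, hper, ?_, ?_⟩
  · rw [Function.IsPeriodicPt, Equiv.Perm.iterate_eq_pow, hπ]; rfl
  · rintro ⟨i, j⟩ ⟨i', j'⟩ h
    simp only at h
    have hii : i = i' := by
      have h1 : Quotient.mk s (a i) = Quotient.mk s (a i') := by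
        refine Quotient.sound (show π.SameCycle _ _ from ?_)
        have := (Equiv.Perm.SameCycle.refl π ((π ^ (j : ℕ)) (a i)))
        conv at this => rhs; rw [h]
        simpa using this
      rwa [Quotient.out_eq, Quotient.out_eq] at h1
    subst hii
    congr 1
    refine Fin.ext (Function.iterate_injOn_Iio_minimalPeriod (f := π) (x := a i) j.2 j'.2 ?_)
    simpa [Equiv.Perm.iterate_eq_pow] using h
  · intro ω
    obtain ⟨m, hm⟩ := (ha ω).exists_nat_pow_eq
    exact ⟨⟨Quotient.mk s ω, m % _, Nat.mod_lt _ (hpos _)⟩, (hmod _ m).trans hm⟩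

theorem Module.Basis.hasOrbitBasis {R M : Type*} [CommRing R] [AddCommGroup M] [Module R M]
    {L : Submodule R M} {Ω : Type} [Finite Ω] (b : Module.Basis Ω R L) {T : Module.End R M}
    (π : Equiv.Perm Ω) {n : ℕ} (hπ : π ^ n = 1) (hT : ∀ ω, T (b ω) = b (π ω)) :
    HasOrbitBasis T n L := by
  obtain ⟨ι, _, e, a, he, hper, hbij⟩ := exists_orbit_decomposition π hπ
  have hpow : ∀ m ω, (T ^ m) (b ω) = b ((π ^ m) ω) := by
    intro m ω
    induction m with
    | zero => simp
    | succ m ih => rw [pow_succ', Module.End.mul_apply, ih, hT, pow_succ', Equiv.Perm.mul_apply]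
  have hfam : orbitFamily T e (fun i => (b (a i) : M)) =
      (fun ω => (b ω : M)) ∘ fun s : Σ i, Fin (e i) => (π ^ (s.2 : ℕ)) (a s.1) := by
    ext s
    exact hpow _ _
  refine ⟨ι, ‹_›, e, fun i => b (a i), he, fun i => ?_, ?_, ?_⟩
  · rw [hpow, hper]
  · rw [hfam]
    exact (b.linearIndependent.map' L.subtype (LinearMap.ker_eq_bot.2 L.injective_subtype)).comp _
      hbij.injective
  · rw [hfam, hbij.surjective.range_comp]
    change Submodule.span R (Set.range (L.subtype ∘ b)) = L
    rw [Set.range_comp, ← Submodule.map_span, b.span_eq, Submodule.map_subtype_top]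

namespace Representation

variable {R G M : Type*} [CommRing R] [Group G] [AddCommGroup M] [Module R M]

theorem IsPermutation.exists_basis {ρ : Representation R G M} (h : ρ.IsPermutation) :
    ∃ (Ω : Type) (_ : Finite Ω) (_ : MulAction G Ω) (b : Module.Basis Ω R M),
      ∀ g ω, ρ g (b ω) = b (g • ω) := by
  obtain ⟨Ω, hΩ, hG, ⟨φ⟩⟩ := h
  let b₀ : Module.Basis Ω R (MonoidAlgebra R Ω) :=
    (Finsupp.basisSingleOne (R := R)).map (MonoidAlgebra.coeffLinearEquiv R).symm
  have hb₀ : ∀ ω, b₀ ω = MonoidAlgebra.single ω 1 := fun ω => by simp [b₀]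
  refine ⟨Ω, hΩ, hG, b₀.map φ.toLinearEquiv.symm, fun g ω => ?_⟩
  apply φ.toLinearEquiv.injective
  have := LinearMap.congr_fun (φ.isIntertwining' g) (φ.toLinearEquiv.symm (b₀ ω))
  simp only [LinearMap.comp_apply] at this
  simp only [Module.Basis.map_apply, LinearEquiv.apply_symm_apply]
  refine this.trans ?_
  change ofMulAction R G Ω g (φ.toLinearEquiv (φ.toLinearEquiv.symm (b₀ ω))) = _
  rw [LinearEquiv.apply_symm_apply, hb₀, hb₀, ofMulAction_single]

theorem isPermutation_of_basis {ρ : Representation R G M} [Nontrivial R] {Ω : Type} [Finite Ω]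
    (b : Module.Basis Ω R M) (h : ∀ g ω, ∃ ω', ρ g (b ω) = b ω') : ρ.IsPermutation := by
  choose f hf using h
  let _ : MulAction G Ω :=
    { smul := f
      one_smul := fun ω => b.injective (by
        change b (f 1 ω) = b ω
        rw [← hf, map_one]; rfl)
      mul_smul := fun g g' ω => b.injective (by
        change b (f (g * g') ω) = b (f g (f g' ω))
        rw [← hf, ← hf, ← hf, map_mul]; rfl) }
  let b₀ : Module.Basis Ω R (MonoidAlgebra R Ω) :=
    (Finsupp.basisSingleOne (R := R)).map (MonoidAlgebra.coeffLinearEquiv R).symm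
  have hb₀ : ∀ ω, b₀ ω = MonoidAlgebra.single ω 1 := fun ω => by simp [b₀]
  have he : ∀ ω, b.equiv b₀ (_root_.Equiv.refl Ω) (b ω) = b₀ ω := fun ω => by simp
  refine ⟨Ω, ‹_›, ‹_›, ⟨Equiv.mk (b.equiv b₀ (_root_.Equiv.refl Ω)) fun g => b.ext fun ω => ?_⟩⟩
  simp only [LinearMap.comp_apply, LinearEquiv.coe_coe]
  rw [hf, he, he, hb₀, hb₀, ofMulAction_single]
  rfl

theorem isPermutation_of_hasOrbitBasis {ρ : Representation R G M} [Nontrivial R] [Finite G]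
    {g : G} (hg : ∀ x, x ∈ Subgroup.zpowers g) {n : ℕ} (hn : n ≠ 0)
    (h : HasOrbitBasis (ρ g) n ⊤) : ρ.IsPermutation := by
  obtain ⟨ι, _, e, x, he, hb⟩ := h
  have he0 : ∀ i, 0 < e i := fun i =>
    Nat.pos_of_ne_zero fun h => hn (Nat.eq_zero_of_zero_dvd (h ▸ he i))
  let b := Module.Basis.mk hb.linearIndependent hb.span_eq.ge
  refine isPermutation_of_basis b fun y s => ?_
  obtain ⟨m, rfl⟩ := (mem_powers_iff_mem_zpowers (y := y)).2 (hg y)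
  obtain ⟨i, j⟩ := s
  refine ⟨⟨i, (m + j) % e i, Nat.mod_lt _ (he0 i)⟩, ?_⟩
  simp only [b, Module.Basis.mk_apply, orbitFamily, map_pow]
  rw [Module.End.pow_mod_apply_of_periodic (hb.period i), pow_add, Module.End.mul_apply]

end Representation

/-! ### The theorem for cyclic `p`-groups -/

theorem corollaryB (p : ℕ) (hp : p.Prime)
    {R : Type*} [CommRing R] [IsDomain R] [IsDiscreteValuationRing R] [CharZero R]
    (hR : IsLocalRing.maximalIdeal R = Ideal.span {(p : R)})
    {G : Type*} [Group G] [Finite G] [IsCyclic G] (hG : IsPGroup p G)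
    (N : Subgroup G) [N.Normal]
    {M : Type*} [AddCommGroup M] [Module R M] (ρ : Representation R G M)
    (hM : ρ.IsLattice)
    (hres : Representation.IsPermutation (ρ.comp N.subtype))
    (hinv : Representation.IsPermutation (ρ.quotientToInvariants N)) :
    ρ.IsPermutation := by
  have hp0 : (p : R) ≠ 0 := Nat.cast_ne_zero.2 hp.ne_zero
  obtain ⟨g, hg⟩ := IsCyclic.exists_generator (α := G)
  have : Fact p.Prime := ⟨hp⟩
  obtain ⟨n, hn⟩ := IsPGroup.iff_card.1 hG
  obtain ⟨m, hmn, hm⟩ := (Nat.dvd_prime_pow hp).1 (hn ▸ N.index_dvd_card)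
  have hgm : g ^ p ^ m ∈ N := hm ▸ N.pow_index_mem g
  -- The subgroup generated by `g ^ p ^ m` lies in `N` and has the same order `p ^ (n - m)`.
  have hNgen : Subgroup.zpowers (g ^ p ^ m) = N := by
    refine Subgroup.eq_of_le_of_card_ge (by simpa using hgm) ?_
    have h1 := N.card_mul_index
    have hord : orderOf g = p ^ n := hn ▸ orderOf_eq_card_of_forall_mem_zpowers hg
    have h2 : Nat.card (Subgroup.zpowers (g ^ p ^ m)) * p ^ m = p ^ n := by
      rw [Nat.card_zpowers, orderOf_pow, hord,
        Nat.gcd_eq_right (pow_dvd_pow p hmn), Nat.div_mul_cancel (pow_dvd_pow p hmn)]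
    rw [hm, hn, ← h2] at h1
    exact (Nat.eq_of_mul_eq_mul_right (pow_pos hp.pos m) h1).le
  set T : Module.End R M := ρ g with hT
  obtain ⟨Ω, _, _, b, hb⟩ := hres.exists_basis
  have : Module.Free R M := Module.Free.of_basis b
  have : Module.Finite R M := Module.Finite.of_basis b
  -- vanishing of cohomology of the subgroups of `N`
  have H : ∀ k, m ≤ k → ∀ y, (∑ j ∈ Finset.range p, (T ^ p ^ k) ^ j) y = 0 →
      ∃ z, y = (T ^ p ^ k) z - z := by
    intro k hk y hy
    have hgk : g ^ p ^ k ∈ N := by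
      obtain ⟨d, hd⟩ := pow_dvd_pow p hk
      rw [hd, pow_mul]
      exact N.pow_mem hgm d
    -- A vanishing norm gives `p y = (T ^ p ^ k - 1) (- Ψ y)`. Since `g ^ p ^ k` lies in `N`, it
    -- permutes the basis `b`, so `p` can be cancelled.
    obtain ⟨Ψ, hΨ⟩ := exists_geomSum_eq (T ^ p ^ k) p
    refine b.mem_range_sub_one_of_smul_mem (MulAction.toPerm (⟨g ^ p ^ k, hgk⟩ : N))
      (fun ω => ?_) hp0 (z := - Ψ y) ?_
    · rw [hT, ← map_pow]
      exact hb ⟨g ^ p ^ k, hgk⟩ ω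
    · have := LinearMap.congr_fun hΨ y
      rw [hy, LinearMap.add_apply, Module.End.mul_apply, Module.End.natCast_apply,
        ← Nat.cast_smul_eq_nsmul R, LinearMap.sub_apply, Module.End.one_apply] at this
      rw [eq_neg_of_add_eq_zero_left this.symm, map_neg]; abel
  have hinvker : Representation.invariants (ρ.comp N.subtype) = LinearMap.ker (T ^ p ^ m - 1) := by
    ext v
    rw [Representation.mem_invariants, Module.End.mem_ker_pow_sub_one, hT, ← map_pow]
    refine ⟨fun h => h ⟨_, hgm⟩, ?_⟩
    rintro h ⟨y, hy⟩
    obtain ⟨d, hd⟩ := mem_powers_iff_mem_zpowers.2 (hNgen ▸ hy)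
    change ρ y v = v
    rw [← hd]
    change ρ ((g ^ p ^ m) ^ d) v = v
    rw [map_pow]
    clear hd
    induction d with
    | zero => rfl
    | succ d ih => rw [pow_succ, Module.End.mul_apply, h]; exact ih
  have hbase : HasOrbitBasis T (p ^ m) (LinearMap.ker (T ^ p ^ m - 1)) := by
    obtain ⟨Ω', _, _, b', hb'⟩ := hinv.exists_basis
    rw [← hinvker]
    -- The generator acts on the invariants through its class in `G ⧸ N`, whose `p ^ m`-th power is
    -- trivial.
    refine b'.hasOrbitBasis (MulAction.toPerm (g : G ⧸ N)) ?_ fun ω => ?_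
    · ext ω
      rw [← MulAction.toPermHom_apply, ← map_pow, ← QuotientGroup.mk_pow,
        (QuotientGroup.eq_one_iff _).2 hgm, map_one]
    · exact congrArg Subtype.val (hb' (g : G ⧸ N) ω)
  have hall : ∀ k, m ≤ k → HasOrbitBasis T (p ^ k) (LinearMap.ker (T ^ p ^ k - 1)) := by
    intro k hk
    induction k, hk using Nat.le_induction with
    | base => exact hbase
    | succ k hk ih => exact ih.succ hp hp0 hR (H k hk)
  refine Representation.isPermutation_of_hasOrbitBasis hg (pow_ne_zero n hp.ne_zero) ?_
  have htop : LinearMap.ker (T ^ p ^ n - 1) = ⊤ := by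
    rw [hT, ← map_pow, ← hn, pow_card_eq_one', map_one, sub_self, LinearMap.ker_zero]
  exact htop ▸ hall n hmn
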